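/- **Proposition (A priori strong maximum principle).** Let $V$ be a real signed Radon measure on $\mathbb R^3$ (for instance $V=v\,dx$ with a real function $v\in L^1_{loc}$) that is locally in the Kato class: for every $y\in\mathbb R^3$ there is $R>0$ with $$\int_{B(y,R)}\frac{d|V|(x)}{|x-y|}<\infty .$$ Let $\mathcal K_0$ be the closure of $C_c^\infty(\mathbb R^3)$ in the norm $\|h\|_{\mathcal K}=\sup_{y\in\mathbb R^3}\int_{\mathbb R^3}\frac{|h(x)|}{|x-y|}\,dx$, and for $h\in\mathcal K_0$ put $(\Delta^{-1}h)(x)=-\frac1{4\pi}\int_{\mathbb R^3}\frac{h(y)}{|x-y|}\,dy$. Let $f:\mathbb R^3\to[0,\infty)$ lie in $(\Delta^{-1}\mathcal K_0)_{loc}$, i.e. every point of $\mathbb R^3$ has a neighbourhood on which $f$ coincides with $\Delta^{-1}h$ for some $h\in\mathcal K_0$ (so $f$ is continuous). Suppose that $f$ solves $$-\Delta f+Vf=g\ge 0,\qquad \liminf_{x\to\infty}f(x)\ge 0,$$ where $g$ is a non-negative Radon measure on $\mathbb R^3$ and the equation holds in the sense of distributions. If $f\not\equiv0$, then $f(x)>0$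 for every $x\in\mathbb R^3$. -/

import Mathlib

open MeasureTheory Filter Topology
open scoped ENNReal

namespace StrongMax

/-- Euclidean three-space. -/
abbrev E3 : Type := EuclideanSpace ℝ (Fin 3)

/-- Real-valued test functions on `ℝ³`: smooth with compact support. -/
def IsTest (φ : E3 → ℝ) : Prop :=
  ContDiff ℝ ((⊤ : ℕ∞) : WithTop ℕ∞) φ ∧ HasCompactSupport φ

/-- The global Kato norm `sup_y ∫ |h(x)| / |x - y| dx`, with values in `[0, ∞]`. -/
noncomputable def katoNorm (h : E3 → ℝ) : ℝ≥0∞ :=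
  ⨆ y : E3, ∫⁻ x, ‖h x‖ₑ / ‖x - y‖ₑ

/-- `𝒦₀`: the closure of the test functions in the global Kato norm. (The Kato norm dominates the
`L¹` norm on each ball, so limits of test functions are functions.) -/
def MemK0 (h : E3 → ℝ) : Prop :=
  AEStronglyMeasurable h volume ∧
    ∀ ε : ℝ≥0∞, 0 < ε → ∃ φ : E3 → ℝ, IsTest φ ∧ katoNorm (h - φ) ≤ ε

/-- The inverse Laplacian on `ℝ³`: `(Δ⁻¹ h)(x) = -(4π)⁻¹ ∫ h(y) / |x - y| dy`. -/
noncomputable def invLaplacian (h : E3 → ℝ) (x : E3) : ℝ :=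
  -(4 * Real.pi)⁻¹ * ∫ y, h y / ‖x - y‖

/-- `(Δ⁻¹ 𝒦₀)_loc`: near each point, `f` coincides with some `Δ⁻¹ h`, `h ∈ 𝒦₀`. -/
def MemInvLaplacianK0Loc (f : E3 → ℝ) : Prop :=
  ∀ y : E3, ∃ h : E3 → ℝ, MemK0 h ∧ ∀ᶠ x in 𝓝 y, f x = invLaplacian h x

/-- A real (signed) Radon measure on `ℝ³`, possibly of infinite total variation, given by its
Jordan decomposition `V = V⁺ - V⁻`. A real locally integrable function `v` is the case in which
`V⁺` and `V⁻` have the densities `max v 0` and `max (-v) 0` with respect to Lebesgue measure. -/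
structure Potential where
  /-- the positive part -/
  pos : Measure E3
  /-- the negative part -/
  neg : Measure E3
  finite_pos : IsLocallyFiniteMeasure pos
  finite_neg : IsLocallyFiniteMeasure neg
  singular : Measure.MutuallySingular pos neg

/-- The total variation measure `|V| = V⁺ + V⁻`. -/
noncomputable def Potential.abs (V : Potential) : Measure E3 :=
  V.pos + V.neg

/-- `∫ u dV` for the signed measure `V`. -/
noncomputable def Potential.integral (V : Potential) (u : E3 → ℝ) : ℝ :=
  ∫ x, u x ∂V.pos - ∫ x, u x ∂V.neg

/-- `V ∈ 𝒦_loc`: for each `y` there is `R > 0` with `∫_{B(y,R)} |x - y|⁻¹ d|V|(x) < ∞`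
(the integrand is `∞` at `x = y`). -/
def Potential.MemKLoc (V : Potential) : Prop :=
  ∀ y : E3, ∃ R : ℝ, 0 < R ∧ ∫⁻ x in Metric.ball y R, ‖x - y‖ₑ⁻¹ ∂V.abs < ∞

/-- `-Δf + V f = g` in the sense of distributions, for a continuous `f`
and a non-negative Radon measure `g`. -/
def IsDistribSolution (V : Potential) (f : E3 → ℝ) (g : Measure E3) : Prop :=
  ∀ φ : E3 → ℝ, IsTest φ →
    -(∫ x, f x * Laplacian.laplacian φ x) + V.integral (fun x => f x * φ x) =
      ∫ x, φ x ∂g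

/-- `f` solves the boundary-value problem `-Δf + V f = g ≥ 0`, `liminf_{x → ∞} f(x) ≥ 0`. Here `g`
is a non-negative Radon measure, which is the same as a non-negative distribution. -/
def SolvesBVP (V : Potential) (f : E3 → ℝ) (g : Measure E3) : Prop :=
  IsLocallyFiniteMeasure g ∧ IsDistribSolution V f g ∧
    0 ≤ liminf (fun x => (f x : EReal)) (cocompact E3)

end StrongMax

/-! The zero set of `f` is closed because `f` is continuous. The point is that it is also open;
connectedness of `ℝ³` then finishes the argument.

Since `f ≥ 0`, dropping `g` and `V⁻` leaves `Δf ≤ V⁺ f`. Formally, `Δ log(1 + f/δ) ≤ Δf / (f + δ) ≤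
V⁺` for every `δ > 0`: the square of the gradient enters with a good sign, and the bound does not
depend on `δ`. Pair this with a compactly supported kernel `k ≈ 1/|x - y|` for which `Δk = b - a`,
where `b ≥ 0` is bounded and `a ≥ 0` concentrates at `y`. Then `∫ log(1 + f/δ) b ≤ ∫ k dV⁺ + ∫ log(1
+ f/δ) a`. The first term is finite by the local Kato condition at `y`; the second stays bounded
because the logarithm vanishes at a zero `y` of `f`. If `f > 0` at a nearby point where `b` is
bounded below, the left side tends to infinity as `δ → 0`, a contradiction.

The formal computation is justified by mollifying `f` before taking the logarithm
(`exists_smooth_log`). The kernel is explicit (`laplacian_kernel`), and the Kato term is bounded by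
Tonelli (`integral_laplacian_mul_kernel_le`). These combine in `integral_log_mul_outerDensity_le`,
and `IsSupersolution.eq_zero_of_mem_ball` lets `δ` be small. -/

namespace StrongMax

/-! ### Continuity of Newtonian potentials -/

theorem locallyIntegrable_norm_inv : LocallyIntegrable (fun x : E3 => ‖x‖⁻¹) volume := by
  refine locallyIntegrable_of_norm_le_rpow (C := 1) (α := 1) (by simp) (by norm_num)
    (Eventually.of_forall fun x => ?_) (by fun_prop)
  rw [Real.rpow_neg_one]
  simp

theorem IsTest.integrable_div_norm {φ : E3 → ℝ} (hφ : IsTest φ) (x : E3) :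
    Integrable (fun y => φ y / ‖x - y‖) := by
  have := hφ.2.convolutionExists_left (ContinuousLinearMap.mul ℝ ℝ) hφ.1.continuous
    locallyIntegrable_norm_inv x
  simpa [ConvolutionExistsAt, div_eq_mul_inv] using this

theorem IsTest.continuous_invLaplacian {φ : E3 → ℝ} (hφ : IsTest φ) :
    Continuous (invLaplacian φ) := by
  have := hφ.2.continuous_convolution_left (ContinuousLinearMap.mul ℝ ℝ) hφ.1.continuous
    locallyIntegrable_norm_inv
  have h2 : Continuous (fun x => ∫ y, φ y / ‖x - y‖) := by
    simp only [div_eq_mul_inv]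
    exact this
  exact continuous_const.mul h2

theorem lintegral_enorm_div_norm_le (h : E3 → ℝ) (x : E3) :
    ∫⁻ y, ‖h y / ‖x - y‖‖ₑ ≤ katoNorm h := by
  refine le_trans (lintegral_mono_ae ?_) (le_iSup (fun y => ∫⁻ x, ‖h x‖ₑ / ‖x - y‖ₑ) x)
  have : ∀ᵐ y : E3, y ≠ x := by simp [ae_iff, measure_singleton]
  filter_upwards [this] with y hy
  have h0 : ‖x - y‖ ≠ 0 := by simpa [sub_eq_zero] using hy.symm
  rw [div_eq_mul_inv, enorm_mul, enorm_inv h0, enorm_norm, ← div_eq_mul_inv, enorm_sub_rev]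

/-- The Kato norm dominates the supremum of the Newtonian potential up to the factor `4π`, so the
potential of `h` is a uniform limit of the continuous potentials of test functions. -/
theorem MemK0.continuous_invLaplacian {h : E3 → ℝ} (hh : MemK0 h) :
    Continuous (invLaplacian h) := by
  refine continuous_of_uniform_approx_of_continuous fun s hs => ?_
  obtain ⟨ε, hε, hεs⟩ := Metric.mem_uniformity_dist.1 hs
  set η : ℝ := 4 * Real.pi * (ε / 2) with hη
  have hη0 : 0 < η := by positivity
  obtain ⟨φ, hφ, hle⟩ := hh.2 (ENNReal.ofReal η) (by simpa using hη0)
  refine ⟨invLaplacian φ, hφ.continuous_invLaplacian, fun x => hεs ?_⟩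
  have hfin := (lintegral_enorm_div_norm_le (h - φ) x).trans hle
  have hint : Integrable (fun y => (h - φ) y / ‖x - y‖) := by
    refine ⟨?_, lt_of_le_of_lt hfin ENNReal.ofReal_lt_top⟩
    have h1 : AEStronglyMeasurable (h - φ) volume :=
      hh.1.sub hφ.1.continuous.aestronglyMeasurable
    exact h1.div₀ (by fun_prop)
  have heq : ∫ y, h y / ‖x - y‖ = (∫ y, (h - φ) y / ‖x - y‖) + ∫ y, φ y / ‖x - y‖ := by
    rw [← integral_add hint (hφ.integrable_div_norm x)]
    congr 1; ext y; simp only [Pi.sub_apply]; ring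
  have hb : ‖∫ y, (h - φ) y / ‖x - y‖‖ ≤ η := by
    have := (enorm_integral_le_lintegral_enorm (fun y => (h - φ) y / ‖x - y‖)).trans hfin
    rwa [← ofReal_norm, ENNReal.ofReal_le_ofReal_iff hη0.le] at this
  rw [Real.dist_eq]
  unfold invLaplacian
  rw [heq, mul_add, add_sub_cancel_right, abs_mul, abs_neg, abs_of_nonneg (by positivity)]
  rw [Real.norm_eq_abs] at hb
  calc _ ≤ (4 * Real.pi)⁻¹ * η := by gcongr
    _ = ε / 2 := by rw [hη]; field_simp
    _ < ε := by linarith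

theorem MemInvLaplacianK0Loc.continuous {f : E3 → ℝ} (hf : MemInvLaplacianK0Loc f) :
    Continuous f := by
  refine continuous_iff_continuousAt.2 fun y => ?_
  obtain ⟨h, hh, he⟩ := hf y
  exact hh.continuous_invLaplacian.continuousAt.congr (EventuallyEq.symm he)

/-! ### The Laplacian in coordinates -/

/-- The standard basis vectors. -/
noncomputable abbrev stdVec (i : Fin 3) : E3 := EuclideanSpace.basisFun (Fin 3) ℝ i

theorem laplacian_eq_sum_fderiv (u : E3 → ℝ) (x : E3) :
    Laplacian.laplacian u x = ∑ i, fderiv ℝ (fderiv ℝ u) x (stdVec i) (stdVec i) := by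
  rw [InnerProductSpace.laplacian_eq_iteratedFDeriv_orthonormalBasis u
    (EuclideanSpace.basisFun (Fin 3) ℝ)]
  simp [iteratedFDeriv_two_apply]

theorem continuous_laplacian {u : E3 → ℝ} (hu : ContDiff ℝ 2 u) :
    Continuous (Laplacian.laplacian u) := by
  have h1 : ContDiff ℝ 1 (fderiv ℝ u) := hu.fderiv_right (by norm_num)
  have h2 : Continuous (fderiv ℝ (fderiv ℝ u)) := h1.continuous_fderiv (by norm_num)
  rw [show Laplacian.laplacian u = fun x => ∑ i, fderiv ℝ (fderiv ℝ u) x (stdVec i) (stdVec i)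
    from funext (laplacian_eq_sum_fderiv u)]
  fun_prop

/-- Chain rule `Δ(G ∘ w) = G' Δw + G'' |∇w|²`. The hypotheses on `G` are local at `w x` because the
profiles used later (square root, truncated `1/s`, logarithm) are singular elsewhere. -/
theorem laplacian_comp {G G' : ℝ → ℝ} {c : ℝ} {w : E3 → ℝ} (hw : ContDiff ℝ 2 w) {x : E3}
    (hG : ∀ᶠ s in 𝓝 (w x), HasDerivAt G (G' s) s) (hG' : HasDerivAt G' c (w x)) :
    Laplacian.laplacian (fun z => G (w z)) x =
      G' (w x) * Laplacian.laplacian w x + c * ∑ i, (fderiv ℝ w x (stdVec i)) ^ 2 := by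
  have hwd : Differentiable ℝ w := hw.differentiable (by norm_num)
  have h1 : ContDiff ℝ 1 (fderiv ℝ w) := hw.fderiv_right (by norm_num)
  have e1 : fderiv ℝ (fun z => G (w z)) =ᶠ[𝓝 x] fun z => G' (w z) • fderiv ℝ w z := by
    filter_upwards [hw.continuous.continuousAt.eventually hG] with z hz
    exact (hz.comp_hasFDerivAt z (hwd z).hasFDerivAt).fderiv
  have e2 := ((hG'.comp_hasFDerivAt x (hwd x).hasFDerivAt).smul
    ((h1.differentiable (by norm_num)) x).hasFDerivAt).fderiv
  rw [laplacian_eq_sum_fderiv, laplacian_eq_sum_fderiv, e1.fderiv_eq]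
  change fderiv ℝ (fun z => G' (w z) • fderiv ℝ w z) x = _ at e2
  rw [e2, Finset.mul_sum, Finset.mul_sum, ← Finset.sum_add_distrib]
  refine Finset.sum_congr rfl fun i _ => ?_
  simp
  ring

/-- Green's identity when one of the functions has compact support. -/
theorem integral_mul_laplacian_comm {u ψ : E3 → ℝ} (hu : ContDiff ℝ 2 u) (hψ : ContDiff ℝ 2 ψ)
    (hs : HasCompactSupport ψ) :
    ∫ x, u x * Laplacian.laplacian ψ x = ∫ x, Laplacian.laplacian u x * ψ x := by
  have hu1 : ContDiff ℝ 1 (fderiv ℝ u) := hu.fderiv_right (by norm_num)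
  have hψ1 : ContDiff ℝ 1 (fderiv ℝ ψ) := hψ.fderiv_right (by norm_num)
  have hu2 : Continuous (fderiv ℝ (fderiv ℝ u)) := hu1.continuous_fderiv (by norm_num)
  have hψ2 : Continuous (fderiv ℝ (fderiv ℝ ψ)) := hψ1.continuous_fderiv (by norm_num)
  have hs1 : HasCompactSupport (fderiv ℝ ψ) := hs.fderiv ℝ
  have hs2 : HasCompactSupport (fderiv ℝ (fderiv ℝ ψ)) := hs1.fderiv ℝ
  have hcu := hu.continuous
  have hcψ := hψ.continuous
  have hcu1 := hu1.continuous
  have hcψ1 := hψ1.continuous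
  have aux : ∀ (w : E3 → ℝ) (i : Fin 3), ContDiff ℝ 1 (fderiv ℝ w) → ∀ x,
      fderiv ℝ (fun z => fderiv ℝ w z (stdVec i)) x (stdVec i) =
        fderiv ℝ (fderiv ℝ w) x (stdVec i) (stdVec i) := by
    intro w i hw x
    rw [fderiv_clm_apply ((hw.differentiable (by norm_num)) x) (by fun_prop)]
    simp
  have hsv : ∀ v : E3, HasCompactSupport fun x => fderiv ℝ ψ x v := fun v =>
    hs1.comp_left (g := fun L : E3 →L[ℝ] ℝ => L v) (by simp)
  have hsv2 : ∀ v : E3, HasCompactSupport fun x => fderiv ℝ (fderiv ℝ ψ) x v v := fun v =>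
    hs2.comp_left (g := fun L : E3 →L[ℝ] E3 →L[ℝ] ℝ => L v v) (by simp)
  have hI2 : ∀ v, Integrable fun x => u x * fderiv ℝ (fderiv ℝ ψ) x v v := fun v =>
    Continuous.integrable_of_hasCompactSupport (by fun_prop) (hsv2 v).mul_left
  have hI1 : ∀ v, Integrable fun x => fderiv ℝ u x v * fderiv ℝ ψ x v := fun v =>
    Continuous.integrable_of_hasCompactSupport (by fun_prop) (hsv v).mul_left
  have hI0 : ∀ v, Integrable fun x => fderiv ℝ (fderiv ℝ u) x v v * ψ x := fun v =>
    Continuous.integrable_of_hasCompactSupport (by fun_prop) hs.mul_left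
  have hJ0 : ∀ v, Integrable fun x => u x * fderiv ℝ ψ x v := fun v =>
    Continuous.integrable_of_hasCompactSupport (by fun_prop) (hsv v).mul_left
  have hJ1 : ∀ v, Integrable fun x => fderiv ℝ u x v * ψ x := fun v =>
    Continuous.integrable_of_hasCompactSupport (by fun_prop) hs.mul_left
  simp only [laplacian_eq_sum_fderiv, Finset.mul_sum, Finset.sum_mul]
  rw [integral_finsetSum _ fun i _ => hI2 _, integral_finsetSum _ fun i _ => hI0 _]
  refine Finset.sum_congr rfl fun i _ => ?_
  have A := integral_mul_fderiv_eq_neg_fderiv_mul_of_integrable (μ := (volume : Measure E3))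
    (f := u) (g := fun z => fderiv ℝ ψ z (stdVec i)) (v := stdVec i)
    (hI1 _) (by simpa only [aux ψ i hψ1] using hI2 (stdVec i)) (hJ0 _)
    (fun x _ => hu.differentiable (by norm_num) x)
    (fun x _ => ((hψ1.differentiable (by norm_num)) x).clm_apply (by fun_prop))
  have B := integral_mul_fderiv_eq_neg_fderiv_mul_of_integrable (μ := (volume : Measure E3))
    (f := fun z => fderiv ℝ u z (stdVec i)) (g := ψ) (v := stdVec i)
    (by simpa only [aux u i hu1] using hI0 (stdVec i)) (hI1 _) (hJ1 _)
    (fun x _ => ((hu1.differentiable (by norm_num)) x).clm_apply (by fun_prop))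
    (fun x _ => hψ.differentiable (by norm_num) x)
  simp only [aux ψ i hψ1] at A
  simp only [aux u i hu1] at B
  rw [A, B, neg_neg]

/-! ### The truncated regularised Newtonian kernel -/

/-- The regularised distance `√(|x - y|² + η²)`. -/
noncomputable def regDist (η : ℝ) (y x : E3) : ℝ := √(‖x - y‖ ^ 2 + η ^ 2)

section kernel
variable {η r : ℝ} (y x : E3)

theorem regDist_sq (η : ℝ) : regDist η y x ^ 2 = ‖x - y‖ ^ 2 + η ^ 2 :=
  Real.sq_sqrt (by positivity)

theorem regDist_pos (hη : 0 < η) : 0 < regDist η y x := Real.sqrt_pos.2 (by positivity)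

theorem norm_le_regDist (η : ℝ) : ‖x - y‖ ≤ regDist η y x :=
  Real.le_sqrt_of_sq_le (by nlinarith [sq_nonneg η])

theorem le_regDist (η : ℝ) : η ≤ regDist η y x :=
  Real.le_sqrt_of_sq_le (by nlinarith [sq_nonneg ‖x - y‖])

theorem contDiff_regDist (hη : 0 < η) : ContDiff ℝ 2 (regDist η y) := by
  unfold regDist
  refine ContDiff.sqrt ?_ fun x => by positivity
  exact ((contDiff_id.sub contDiff_const).norm_sq ℝ).add contDiff_const

theorem hasFDerivAt_norm_sub_sq :
    HasFDerivAt (fun z : E3 => ‖z - y‖ ^ 2) ((2 : ℝ) • innerSL ℝ (x - y)) x := by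
  have := (hasStrictFDerivAt_norm_sq (x - y)).hasFDerivAt.comp x
    ((hasFDerivAt_id x).sub_const y)
  refine (this.congr_fderiv ?_)
  ext v
  simp [two_mul]

theorem sum_inner_stdVec_sq (v : E3) : ∑ i, (inner ℝ v (stdVec i)) ^ 2 = ‖v‖ ^ 2 := by
  rw [← (EuclideanSpace.basisFun (Fin 3) ℝ).sum_sq_norm_inner_left v]
  simp

theorem sum_fderiv_norm_sub_sq :
    ∑ i, (fderiv ℝ (fun z : E3 => ‖z - y‖ ^ 2) x (stdVec i)) ^ 2 = 4 * ‖x - y‖ ^ 2 := by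
  rw [(hasFDerivAt_norm_sub_sq y x).fderiv, ← sum_inner_stdVec_sq (x - y), Finset.mul_sum]
  refine Finset.sum_congr rfl fun i _ => ?_
  rw [smul_apply, innerSL_apply_apply, smul_eq_mul]
  ring

theorem laplacian_norm_sub_sq :
    Laplacian.laplacian (fun z : E3 => ‖z - y‖ ^ 2) x = 6 := by
  rw [laplacian_eq_sum_fderiv]
  have h : fderiv ℝ (fun z : E3 => ‖z - y‖ ^ 2) = fun z => (2 : ℝ) • innerSL ℝ (z - y) :=
    funext fun z => (hasFDerivAt_norm_sub_sq y z).fderiv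
  have h2 : HasFDerivAt (fun z : E3 => (2 : ℝ) • innerSL ℝ (z - y))
      ((2 : ℝ) • (innerSL ℝ : E3 →L[ℝ] E3 →L[ℝ] ℝ)) x :=
    (((innerSL ℝ : E3 →L[ℝ] E3 →L[ℝ] ℝ).hasFDerivAt.comp x
      ((hasFDerivAt_id x).sub_const y)).const_smul (2 : ℝ))
  rw [h, h2.fderiv]
  have h3 : ∀ i, ((2 : ℝ) • (innerSL ℝ : E3 →L[ℝ] E3 →L[ℝ] ℝ)) (stdVec i) (stdVec i) = 2 := by
    intro i
    rw [smul_apply, smul_apply, innerSL_apply_apply, real_inner_self_eq_norm_sq]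
    simp
  simp only [h3]
  norm_num

theorem sum_fderiv_regDist_sq (hη : 0 < η) :
    ∑ i, (fderiv ℝ (regDist η y) x (stdVec i)) ^ 2 = ‖x - y‖ ^ 2 / regDist η y x ^ 2 := by
  have h1 : HasFDerivAt (regDist η y) _ x :=
    ((hasFDerivAt_norm_sub_sq y x).add_const (η ^ 2)).sqrt (by positivity)
  change HasFDerivAt (regDist η y) ((1 / (2 * regDist η y x)) • _) x at h1
  rw [h1.fderiv, ← sum_inner_stdVec_sq (x - y), Finset.sum_div]
  refine Finset.sum_congr rfl fun i _ => ?_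
  rw [smul_apply, smul_apply, innerSL_apply_apply,
    smul_eq_mul, smul_eq_mul]
  have := regDist_pos y x hη
  field_simp

theorem laplacian_regDist (hη : 0 < η) :
    Laplacian.laplacian (regDist η y) x =
      3 / regDist η y x - ‖x - y‖ ^ 2 / regDist η y x ^ 3 := by
  have hD := regDist_pos y x hη
  have hpos : ∀ s : ℝ, 0 < s + η ^ 2 → HasDerivAt (fun s => √(s + η ^ 2)) (1 / (2 * √(s + η ^ 2))) s :=
    fun s hs => ((hasDerivAt_id s).add_const (η ^ 2)).sqrt hs.ne'
  have hx : 0 < ‖x - y‖ ^ 2 + η ^ 2 := by positivity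
  have key := laplacian_comp (G := fun s => √(s + η ^ 2)) (G' := fun s => 1 / (2 * √(s + η ^ 2)))
    (w := fun z : E3 => ‖z - y‖ ^ 2) (x := x) ((contDiff_id.sub contDiff_const).norm_sq ℝ)
    (by
      have : Tendsto (fun s : ℝ => s + η ^ 2) (𝓝 (‖x - y‖ ^ 2)) (𝓝 (‖x - y‖ ^ 2 + η ^ 2)) :=
        (continuous_add_const _).tendsto _
      filter_upwards [this.eventually_const_lt hx] with s hs using hpos s hs)
    ((hasDerivAt_const _ (1 : ℝ)).fun_div ((hpos _ hx).const_mul 2) (by positivity))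
  rw [laplacian_norm_sub_sq, sum_fderiv_norm_sub_sq] at key
  change Laplacian.laplacian (regDist η y) x = 1 / (2 * regDist η y x) * 6 +
    ((0 * (2 * regDist η y x) - 1 * (2 * (1 / (2 * regDist η y x)))) / (2 * regDist η y x) ^ 2) * _
    at key
  rw [key]
  field_simp
  ring

end kernel

/-! ### Regularity of truncated powers -/

theorem hasDerivAt_max_zero_pow (n : ℕ) (s : ℝ) :
    HasDerivAt (fun s : ℝ => max 0 s ^ (n + 2)) ((n + 2) * max 0 s ^ (n + 1)) s := by
  rcases lt_trichotomy s 0 with h | h | h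
  · rw [max_eq_left h.le]
    have : (fun s : ℝ => max 0 s ^ (n + 2)) =ᶠ[𝓝 s] fun _ => 0 := by
      filter_upwards [eventually_lt_nhds h] with t ht
      rw [max_eq_left ht.le]; simp
    simpa using (hasDerivAt_const s (0 : ℝ)).congr_of_eventuallyEq this
  · subst h
    rw [hasDerivAt_iff_isLittleO_nhds_zero]
    simp only [zero_add, max_self, ne_eq, Nat.add_eq_zero_iff, OfNat.ofNat_ne_zero, and_false,
      not_false_eq_true, zero_pow, sub_zero, one_ne_zero, mul_zero, smul_zero]
    have h1 : (fun h : ℝ => max 0 h ^ (n + 2)) =O[𝓝 0] fun h => h ^ (n + 2) := by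
      refine Asymptotics.IsBigO.of_bound 1 (Eventually.of_forall fun h => ?_)
      rw [norm_pow, norm_pow, one_mul]
      refine pow_le_pow_left₀ (norm_nonneg _) ?_ _
      rw [Real.norm_eq_abs, Real.norm_eq_abs, abs_of_nonneg (le_max_left 0 h)]
      exact max_le (abs_nonneg _) (le_abs_self _)
    exact h1.trans_isLittleO (by simpa using Asymptotics.isLittleO_pow_id (𝕜 := ℝ) (n := n + 2) (by omega))
  · rw [max_eq_right h.le]
    have : (fun s : ℝ => max 0 s ^ (n + 2)) =ᶠ[𝓝 s] fun s => s ^ (n + 2) := by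
      filter_upwards [eventually_gt_nhds h] with t ht
      rw [max_eq_right ht.le]
    simpa using (hasDerivAt_pow (n + 2) s).congr_of_eventuallyEq this

/-- Two derivatives of the cube leave a multiple of `max 0 s`, which is still continuous; this is
why the kernel is cut off with a third power. -/
theorem contDiff_max_zero_cube : ContDiff ℝ 2 (fun s : ℝ => max 0 s ^ 3) := by
  have d1 : deriv (fun s : ℝ => max 0 s ^ 3) = fun s => 3 * max 0 s ^ 2 := by
    funext s
    have := (hasDerivAt_max_zero_pow 1 s).deriv
    norm_num at this ⊢
    exact this
  have d2 : deriv (fun s : ℝ => max 0 s ^ 2) = fun s => 2 * max 0 s := by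
    funext s
    have := (hasDerivAt_max_zero_pow 0 s).deriv
    norm_num at this ⊢
    exact this
  have c2 : ContDiff ℝ 1 (fun s : ℝ => max 0 s ^ 2) := by
    rw [show (1 : WithTop ℕ∞) = 0 + 1 from rfl, contDiff_succ_iff_deriv, d2]
    refine ⟨fun s => (hasDerivAt_max_zero_pow 0 s).differentiableAt, by simp, ?_⟩
    exact contDiff_zero.2 (by fun_prop)
  rw [show (2 : WithTop ℕ∞) = 1 + 1 from rfl, contDiff_succ_iff_deriv, d1]
  exact ⟨fun s => (hasDerivAt_max_zero_pow 1 s).differentiableAt, by simp, contDiff_const.mul c2⟩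

/-- The truncated kernel `(1 - t)₊³ (1 + t) / D` with `D` the regularised distance and
`t = D / r`. -/
noncomputable def kernel (η r : ℝ) (y x : E3) : ℝ :=
  max 0 (1 - regDist η y x / r) ^ 3 * (1 + regDist η y x / r) / regDist η y x

/-- The part of `-Δ (kernel η r y)` which concentrates at `y` as `η → 0`. -/
noncomputable def innerDensity (η r : ℝ) (y x : E3) : ℝ :=
  3 * η ^ 2 * (max 0 (1 - regDist η y x / r) ^ 2 *
    (1 + 2 * (regDist η y x / r) + 3 * (regDist η y x / r) ^ 2)) / regDist η y x ^ 5

/-- The bounded part of `Δ (kernel η r y)`. -/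
noncomputable def outerDensity (η r : ℝ) (y x : E3) : ℝ :=
  12 / r ^ 3 * max 0 (1 - regDist η y x / r) * (‖x - y‖ ^ 2 / regDist η y x ^ 2)

/-! ### Support, size and Laplacian of the truncated kernel -/

section kernel
variable {η r : ℝ} (y x : E3)

theorem contDiff_kernel (hη : 0 < η) : ContDiff ℝ 2 (kernel η r y) := by
  have h := contDiff_regDist (η := η) y hη
  unfold kernel
  refine ContDiff.div (ContDiff.mul ?_ (contDiff_const.add (h.div_const r))) h
    fun x => (regDist_pos y x hη).ne'
  exact contDiff_max_zero_cube.comp (contDiff_const.sub (h.div_const r))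

theorem max_one_sub_regDist_eq_zero (hr : 0 < r) (hx : r ≤ ‖x - y‖) :
    max 0 (1 - regDist η y x / r) = 0 := by
  refine max_eq_left ?_
  have : 1 ≤ regDist η y x / r := (one_le_div hr).2 (hx.trans (norm_le_regDist y x η))
  linarith

theorem kernel_eq_zero (hr : 0 < r) (hx : r ≤ ‖x - y‖) : kernel η r y x = 0 := by
  simp [kernel, max_one_sub_regDist_eq_zero y x hr hx]

theorem innerDensity_eq_zero (hr : 0 < r) (hx : r ≤ ‖x - y‖) : innerDensity η r y x = 0 := by
  simp [innerDensity, max_one_sub_regDist_eq_zero y x hr hx]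

theorem outerDensity_eq_zero (hr : 0 < r) (hx : r ≤ ‖x - y‖) : outerDensity η r y x = 0 := by
  simp [outerDensity, max_one_sub_regDist_eq_zero y x hr hx]

theorem hasCompactSupport_of_eq_zero {u : E3 → ℝ} (hu : ∀ x, r ≤ ‖x - y‖ → u x = 0) :
    HasCompactSupport u := by
  refine HasCompactSupport.intro (isCompact_closedBall y r) fun x hx => hu x ?_
  rw [Metric.mem_closedBall, dist_eq_norm] at hx
  exact (not_le.1 hx).le

theorem kernel_nonneg (hη : 0 < η) (hr : 0 < r) : 0 ≤ kernel η r y x := by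
  have := regDist_pos y x hη
  unfold kernel
  positivity

theorem innerDensity_nonneg (hη : 0 < η) (hr : 0 < r) : 0 ≤ innerDensity η r y x := by
  have := regDist_pos y x hη
  unfold innerDensity
  positivity

theorem outerDensity_nonneg (hη : 0 < η) (hr : 0 < r) : 0 ≤ outerDensity η r y x := by
  have := regDist_pos y x hη
  unfold outerDensity
  positivity

theorem kernel_le (hη : 0 < η) (hr : 0 < r) : kernel η r y x ≤ (regDist η y x)⁻¹ := by
  have hD := regDist_pos y x hη
  unfold kernel
  rw [div_eq_mul_inv]
  refine mul_le_of_le_one_left (by positivity) ?_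
  have ht : 0 < regDist η y x / r := by positivity
  set t := regDist η y x / r
  rcases le_total 1 t with h | h
  · rw [max_eq_left (by linarith)]; norm_num
  · rw [max_eq_right (by linarith)]
    have h2 : (1 - t) ^ 2 ≤ 1 := by nlinarith
    calc (1 - t) ^ 3 * (1 + t) = (1 - t) ^ 2 * (1 - t ^ 2) := by ring
      _ ≤ 1 * 1 := by gcongr <;> nlinarith
      _ = 1 := by norm_num

theorem innerDensity_le (hη : 0 < η) (hr : 0 < r) :
    innerDensity η r y x ≤ 3 * η ^ 2 / regDist η y x ^ 5 := by
  have hD := regDist_pos y x hη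
  unfold innerDensity
  refine div_le_div_of_nonneg_right ?_ (by positivity)
  refine mul_le_of_le_one_right (by positivity) ?_
  have ht : 0 < regDist η y x / r := by positivity
  set t := regDist η y x / r
  rcases le_total 1 t with h | h
  · rw [max_eq_left (by linarith)]; norm_num
  · rw [max_eq_right (by linarith)]
    have : 0 ≤ t ^ 3 * (4 - 3 * t) := mul_nonneg (by positivity) (by linarith)
    nlinarith

theorem outerDensity_le (hη : 0 < η) (hr : 0 < r) : outerDensity η r y x ≤ 12 / r ^ 3 := by
  have hD := regDist_pos y x hη
  unfold outerDensity
  have h1 : max 0 (1 - regDist η y x / r) ≤ 1 := by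
    refine max_le zero_le_one ?_
    have : 0 < regDist η y x / r := by positivity
    linarith
  have h2 : ‖x - y‖ ^ 2 / regDist η y x ^ 2 ≤ 1 := by
    rw [div_le_one (by positivity), regDist_sq]
    nlinarith [sq_nonneg η]
  calc _ ≤ 12 / r ^ 3 * 1 * 1 := by gcongr
    _ = _ := by ring

/-- A lower bound uniform in `η`, on an annulus away from both the centre and the edge of the
cutoff. It turns a bound on the weighted integral of the logarithm into a contradiction. -/
theorem le_outerDensity (hη : 0 < η) (hr : 0 < r) (hηr : η ≤ r / 4) (h1 : r / 4 ≤ ‖x - y‖)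
    (h2 : ‖x - y‖ ≤ 3 * r / 4) : 1 / (5 * r ^ 3) ≤ outerDensity η r y x := by
  have hD := regDist_pos y x hη
  have hsq := regDist_sq y x η
  have hD2 : regDist η y x ≤ 4 / 5 * r := by
    -- The squared distance is at most `(9/16 + 1/16) r² = 5/8 r²`, below `(4/5)² r²`.
    refine Real.sqrt_le_iff.2 ⟨by positivity, ?_⟩
    nlinarith [norm_nonneg (x - y)]
  have h3 : 1 / 5 ≤ max 0 (1 - regDist η y x / r) := by
    refine le_max_of_le_right ?_
    have : regDist η y x / r ≤ 4 / 5 := by rw [div_le_iff₀ hr]; exact hD2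
    linarith
  have h4 : 1 / 2 ≤ ‖x - y‖ ^ 2 / regDist η y x ^ 2 := by
    rw [le_div_iff₀ (by positivity), hsq]
    nlinarith [norm_nonneg (x - y)]
  unfold outerDensity
  calc 1 / (5 * r ^ 3) ≤ 12 / r ^ 3 * (1 / 5) * (1 / 2) := by
        rw [show 12 / r ^ 3 * (1 / 5) * (1 / 2) = 6 * (1 / (5 * r ^ 3)) by field_simp; norm_num]
        have : 0 < 1 / (5 * r ^ 3) := by positivity
        linarith
    _ ≤ _ := by gcongr

theorem continuous_innerDensity (hη : 0 < η) : Continuous (innerDensity η r y) := by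
  have h := (contDiff_regDist (η := η) y hη).continuous
  unfold innerDensity
  refine Continuous.div (by fun_prop) (by fun_prop) fun x => ?_
  have := regDist_pos y x hη
  positivity

theorem continuous_outerDensity (hη : 0 < η) : Continuous (outerDensity η r y) := by
  have h := (contDiff_regDist (η := η) y hη).continuous
  unfold outerDensity
  refine Continuous.mul (by fun_prop) (Continuous.div (by fun_prop) (by fun_prop) fun x => ?_)
  have := regDist_pos y x hη
  positivity

/-- For `s ≤ r` the radial profile expands to `G(s) = 1/s - 2/r + 2s²/r³ - s³/r⁴`. There is no term
linear in `s`, so `G'' + 2G'/s = 12/r³ (1 - s/r)` is bounded and non-negative. Replacing `|x - y|`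
by `D = √(|x - y|² + η²)` multiplies this by `|x - y|²/D²` and adds `3η² G'(D)/D³`, which is minus
the inner density. -/
theorem laplacian_kernel (hη : 0 < η) (hr : 0 < r) :
    Laplacian.laplacian (kernel η r y) x = outerDensity η r y x - innerDensity η r y x := by
  have hD := regDist_pos y x hη
  have hsq := regDist_sq y x η
  have hinner : ∀ s : ℝ, HasDerivAt (fun s : ℝ => 1 - s / r) (-(1 / r)) s := fun s =>
    ((hasDerivAt_id s).div_const r).const_sub 1
  have hplus : ∀ s : ℝ, HasDerivAt (fun s : ℝ => 1 + s / r) (1 / r) s := fun s =>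
    ((hasDerivAt_id s).div_const r).const_add 1
  have hm3 : ∀ s : ℝ, HasDerivAt (fun s : ℝ => max 0 (1 - s / r) ^ 3)
      (3 * max 0 (1 - s / r) ^ 2 * (-(1 / r))) s := fun s => by
    have := (hasDerivAt_max_zero_pow 1 (1 - s / r)).comp s (hinner s)
    norm_num [Function.comp_def] at this ⊢
    exact this
  have hm2 : ∀ s : ℝ, HasDerivAt (fun s : ℝ => max 0 (1 - s / r) ^ 2)
      (2 * max 0 (1 - s / r) * (-(1 / r))) s := fun s => by
    have := (hasDerivAt_max_zero_pow 0 (1 - s / r)).comp s (hinner s)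
    norm_num [Function.comp_def] at this ⊢
    exact this
  have hpoly : ∀ s : ℝ, HasDerivAt (fun s : ℝ => 1 + 2 * (s / r) + 3 * (s / r) ^ 2)
      (2 / r + 6 * s / r ^ 2) s := fun s => by
    have h0 := (hasDerivAt_id s).div_const r
    have := ((h0.const_mul 2).const_add 1).add ((h0.pow 2).const_mul 3)
    refine this.congr_deriv ?_
    simp
    field_simp
    ring
  have key := laplacian_comp (G := fun s => max 0 (1 - s / r) ^ 3 * (1 + s / r) / s)
    (G' := fun s => -(max 0 (1 - s / r) ^ 2 * (1 + 2 * (s / r) + 3 * (s / r) ^ 2) / s ^ 2))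
    (x := x) (contDiff_regDist y hη)
    (by
      filter_upwards [eventually_gt_nhds hD] with s hs
      refine (((hm3 s).mul (hplus s)).div (hasDerivAt_id s) hs.ne').congr_deriv ?_
      simp only [Pi.mul_apply, id]
      rcases le_total s r with h | h
      · rw [max_eq_right (by rw [sub_nonneg, div_le_one hr]; exact h)]
        field_simp
        ring
      · rw [max_eq_left (by rw [sub_nonpos, one_le_div hr]; exact h)]
        simp)
    ((((hm2 _).mul (hpoly _)).div (hasDerivAt_pow 2 _) (by positivity)).neg)
  rw [sum_fderiv_regDist_sq y x hη, laplacian_regDist y x hη] at key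
  have hk : (fun z => max 0 (1 - regDist η y z / r) ^ 3 * (1 + regDist η y z / r) / regDist η y z)
    = kernel η r y := rfl
  rw [hk] at key
  rw [key]
  have hn : ‖x - y‖ ^ 2 = regDist η y x ^ 2 - η ^ 2 := by linarith
  unfold outerDensity innerDensity
  rw [hn]
  set D := regDist η y x
  simp only [Pi.mul_apply]
  rcases le_total D r with h | h
  · rw [max_eq_right (by rw [sub_nonneg, div_le_one hr]; exact h)]
    field_simp
    ring
  · rw [max_eq_left (by rw [sub_nonpos, one_le_div hr]; exact h)]
    simp

end kernel

/-! ### Mollified logarithms of supersolutions -/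

/-- `-Δ f + μ f ≥ 0` in the sense of distributions, for a non-negative measure `μ`. -/
def IsSupersolution (μ : Measure E3) (f : E3 → ℝ) : Prop :=
  ∀ φ : E3 → ℝ, IsTest φ → (∀ x, 0 ≤ φ x) →
    ∫ x, f x * Laplacian.laplacian φ x ≤ ∫ x, f x * φ x ∂μ

theorem IsDistribSolution.isSupersolution {V : Potential} {f : E3 → ℝ} {g : Measure E3}
    (h : IsDistribSolution V f g) (hf : ∀ x, 0 ≤ f x) : IsSupersolution V.pos f := by
  intro φ hφ h0
  have h1 := h φ hφ
  have h2 : 0 ≤ ∫ x, φ x ∂g := integral_nonneg h0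
  have h3 : 0 ≤ ∫ x, f x * φ x ∂V.neg := integral_nonneg fun x => mul_nonneg (hf x) (h0 x)
  unfold Potential.integral at h1
  linarith

theorem fderiv_comp_sub_left {F : Type*} [NormedAddCommGroup F] [NormedSpace ℝ F] {u : E3 → F}
    (hu : Differentiable ℝ u) (x z : E3) :
    fderiv ℝ (fun z => u (x - z)) z = -fderiv ℝ u (x - z) := by
  have := (hu (x - z)).hasFDerivAt.comp z ((hasFDerivAt_id z).const_sub x)
  have h2 := this.fderiv
  change fderiv ℝ (fun z => u (x - z)) z = _ at h2
  rw [h2]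
  ext v
  simp

theorem laplacian_comp_sub_left {u : E3 → ℝ} (hu : ContDiff ℝ 2 u) (x z : E3) :
    Laplacian.laplacian (fun z => u (x - z)) z = Laplacian.laplacian u (x - z) := by
  have h1 : ContDiff ℝ 1 (fderiv ℝ u) := hu.fderiv_right (by norm_num)
  have e1 : fderiv ℝ (fun z => u (x - z)) = fun z => -fderiv ℝ u (x - z) :=
    funext fun z => fderiv_comp_sub_left (hu.differentiable (by norm_num)) x z
  rw [laplacian_eq_sum_fderiv, laplacian_eq_sum_fderiv, e1, fderiv_fun_neg,
    fderiv_comp_sub_left (h1.differentiable (by norm_num)), neg_neg]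

/-- Both derivatives fall on `ρ`, so continuity of `f` suffices. -/
theorem laplacian_convolution {f ρ : E3 → ℝ} (L : ℝ →L[ℝ] ℝ →L[ℝ] ℝ) (hf : Continuous f)
    (hρ : ContDiff ℝ 2 ρ) (hs : HasCompactSupport ρ) (x : E3) :
    Laplacian.laplacian (convolution f ρ L volume) x =
      ∫ z, L (f z) (Laplacian.laplacian ρ (x - z)) := by
  have hfl : LocallyIntegrable f volume := hf.locallyIntegrable
  have h1 : ContDiff ℝ 1 (fderiv ℝ ρ) := hρ.fderiv_right (by norm_num)
  have hc2 : Continuous (fderiv ℝ (fderiv ℝ ρ)) := h1.continuous_fderiv (by norm_num)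
  have hs1 : HasCompactSupport (fderiv ℝ ρ) := hs.fderiv ℝ
  have hs2 : HasCompactSupport (fderiv ℝ (fderiv ℝ ρ)) := hs1.fderiv ℝ
  have e1 : fderiv ℝ (convolution f ρ L volume) =
      convolution f (fderiv ℝ ρ) (L.precompR E3) volume := funext fun z =>
    (hs.hasFDerivAt_convolution_right L hfl (hρ.of_le (by norm_num)) z).fderiv
  have e2 := (hs1.hasFDerivAt_convolution_right (L.precompR E3) hfl h1 x).fderiv
  have hsv : ∀ v : E3, HasCompactSupport fun z => fderiv ℝ (fderiv ℝ ρ) z v := fun v =>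
    hs2.comp_left (g := fun M : E3 →L[ℝ] E3 →L[ℝ] ℝ => M v) (by simp)
  have hsvv : ∀ v : E3, HasCompactSupport fun z => fderiv ℝ (fderiv ℝ ρ) z v v := fun v =>
    hs2.comp_left (g := fun M : E3 →L[ℝ] E3 →L[ℝ] ℝ => M v v) (by simp)
  have hi : ∀ i : Fin 3, Integrable
      fun z => L (f z) (fderiv ℝ (fderiv ℝ ρ) (x - z) (stdVec i) (stdVec i)) := fun i =>
    (hsvv (stdVec i)).convolutionExists_right L hfl (by fun_prop) x
  rw [laplacian_eq_sum_fderiv, e1, e2]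
  simp only [laplacian_eq_sum_fderiv, map_sum]
  rw [integral_finsetSum _ fun i _ => hi i]
  refine Finset.sum_congr rfl fun i _ => ?_
  rw [convolution_precompR_apply (L.precompR E3) hfl hs2 hc2,
    convolution_precompR_apply L hfl (hsv _) (by fun_prop), convolution_def]

theorem abs_log_sub_log_le {a b : ℝ} (ha : 1 ≤ a) (hb : 1 ≤ b) (h : |a - b| ≤ 1) :
    |Real.log a - Real.log b| ≤ 1 := by
  have key : ∀ s t : ℝ, 1 ≤ s → 1 ≤ t → s - t ≤ 1 → Real.log s - Real.log t ≤ 1 := by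
    intro s t hs ht hst
    rw [← Real.log_div (by positivity) (by positivity)]
    refine (Real.log_le_sub_one_of_pos (by positivity)).trans ?_
    rw [sub_le_iff_le_add, div_le_iff₀ (by positivity)]
    linarith
  rw [abs_le] at h ⊢
  constructor
  · have := key b a hb ha (by linarith)
    linarith
  · exact key a b ha hb (by linarith)

/-- With `w = f * ρ` and `u = log(1 + w/δ)`, one has `Δu ≤ Δw / (w + δ)`, and testing the inequality
for `f` with `ρ(x - ·)` gives `Δw(x) ≤ ∫ f ρ(x - ·) dμ`. If the mollification scale is so small that
`f` oscillates by at most `δ/2`, then `f ≤ w(x) + δ` on the support of `ρ(x - ·)`, and the factor `w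
+ δ` cancels. -/
theorem exists_smooth_log {μ : Measure E3} [IsLocallyFiniteMeasure μ] {f : E3 → ℝ}
    (hf : Continuous f) (h0 : ∀ x, 0 ≤ f x) (hsup : IsSupersolution μ f) (y : E3) (r : ℝ)
    {δ ε : ℝ} (hδ : 0 < δ) (hε : 0 < ε) :
    ∃ u ρ : E3 → ℝ, ContDiff ℝ 2 u ∧ Continuous ρ ∧ (∀ x, 0 ≤ ρ x) ∧ ∫ x, ρ x = 1 ∧
      (∀ x, ε ≤ ‖x‖ → ρ x = 0) ∧ ∀ x ∈ Metric.closedBall y r,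
        |u x - Real.log (1 + f x / δ)| ≤ 1 ∧ Laplacian.laplacian u x ≤ ∫ z, ρ (x - z) ∂μ := by
  have huc := (isCompact_closedBall y (r + 1)).uniformContinuousOn_of_continuous hf.continuousOn
  obtain ⟨κ, hκ, hκf⟩ := Metric.uniformContinuousOn_iff.1 huc (δ / 2) (by positivity)
  -- The bound by `1` keeps mollification of points of `closedBall y r` inside `closedBall y (r +
  -- 1)`, where `f` has modulus `κ`.
  set e : ℝ := min ε (min κ 1) with he
  have he0 : 0 < e := by positivity
  let B : ContDiffBump (0 : E3) := ⟨e / 2, e, by positivity, by linarith⟩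
  set ρ : E3 → ℝ := B.normed volume with hρ
  have hρ0 : ∀ x, 0 ≤ ρ x := B.nonneg_normed
  have hρsupp : Function.support ρ = Metric.ball 0 e := B.support_normed_eq
  have hρz : ∀ x, e ≤ ‖x‖ → ρ x = 0 := by
    intro x hx
    by_contra hne
    have : x ∈ Function.support ρ := hne
    rw [hρsupp, mem_ball_zero_iff] at this
    linarith
  have hρs : HasCompactSupport ρ := B.hasCompactSupport_normed
  have hρc : ∀ {n : ℕ∞}, ContDiff ℝ n ρ := B.contDiff_normed
  have hρcont : Continuous ρ := B.continuous_normed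
  -- Flipped so that `convolution_flip` matches `f * ρ` with the bump-first convolution in
  -- `dist_normed_convolution_le`.
  let L : ℝ →L[ℝ] ℝ →L[ℝ] ℝ := (ContinuousLinearMap.lsmul ℝ ℝ).flip
  set w : E3 → ℝ := convolution f ρ L volume with hw
  have hwC : ContDiff ℝ 2 w :=
    hρs.contDiff_convolution_right (n := 2) L hf.locallyIntegrable hρc
  have hw0 : ∀ x, 0 ≤ w x := fun x => integral_nonneg fun z => mul_nonneg (hρ0 _) (h0 z)
  have hlap : ∀ x, Laplacian.laplacian w x ≤ ∫ z, f z * ρ (x - z) ∂μ := by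
    intro x
    have ht : IsTest fun z => ρ (x - z) :=
      ⟨(hρc (n := ⊤)).comp (contDiff_const.sub contDiff_id),
        hρs.comp_homeomorph (Homeomorph.subLeft x)⟩
    have h1 := hsup _ ht fun z => hρ0 _
    rw [laplacian_convolution L hf (hρc (n := 2)) hρs x]
    refine le_trans (le_of_eq (integral_congr_ae (Eventually.of_forall fun z => ?_))) h1
    simp only [laplacian_comp_sub_left (hρc (n := 2))]
    simp [L, mul_comm]
  have hnear : ∀ x ∈ Metric.closedBall y r, ∀ z ∈ Metric.ball x e, dist (f z) (f x) ≤ δ / 2 := by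
    intro x hx z hz
    rw [Metric.mem_ball] at hz
    rw [Metric.mem_closedBall] at hx
    have e1 : e ≤ κ := (min_le_right _ _).trans (min_le_left _ _)
    have e2 : e ≤ 1 := (min_le_right _ _).trans (min_le_right _ _)
    refine (hκf z ?_ x ?_ (hz.trans_le e1)).le
    · rw [Metric.mem_closedBall]
      linarith [dist_triangle z x y]
    · rw [Metric.mem_closedBall]
      linarith
  have hwf : ∀ x ∈ Metric.closedBall y r, |w x - f x| ≤ δ / 2 := by
    intro x hx
    have := B.dist_normed_convolution_le (μ := (volume : Measure E3)) (g := f) (x₀ := x)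
      (ε := δ / 2) hf.aestronglyMeasurable (hnear x hx)
    rw [← convolution_flip, Real.dist_eq] at this
    exact this
  refine ⟨fun x => Real.log (1 + w x / δ), ρ, ?_, hρcont, hρ0, B.integral_normed,
    fun x hx => hρz x ((min_le_left _ _).trans hx), fun x hx => ⟨?_, ?_⟩⟩
  · refine ContDiff.log (contDiff_const.add (hwC.div_const δ)) fun x => ?_
    have := hw0 x
    positivity
  · refine abs_log_sub_log_le ?_ ?_ ?_
    · have := hw0 x
      have : 0 ≤ w x / δ := by positivity
      linarith
    · have := h0 x
      have : 0 ≤ f x / δ := by positivity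
      linarith
    · rw [show 1 + w x / δ - (1 + f x / δ) = (w x - f x) / δ by ring, abs_div, abs_of_pos hδ,
        div_le_one hδ]
      linarith [hwf x hx]
  · have hpos : 0 < w x + δ := by linarith [hw0 x]
    have hGd : ∀ s : ℝ, 0 < s + δ → HasDerivAt (fun s => Real.log (1 + s / δ)) ((s + δ)⁻¹) s := by
      intro s hs
      have heq : 1 + s / δ = (s + δ) / δ := by field_simp; ring
      have hne : 1 + s / δ ≠ 0 := by rw [heq]; positivity
      refine ((((hasDerivAt_id s).div_const δ).const_add 1).log hne).congr_deriv ?_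
      simp only [id]
      rw [heq]
      field_simp
    have key := laplacian_comp (G := fun s => Real.log (1 + s / δ)) (G' := fun s => (s + δ)⁻¹)
      (x := x) hwC
      (by
        have : Tendsto (fun s : ℝ => s + δ) (𝓝 (w x)) (𝓝 (w x + δ)) :=
          (continuous_add_const _).tendsto _
        filter_upwards [this.eventually_const_lt hpos] with s hs using hGd s hs)
      (((hasDerivAt_id (w x)).add_const δ).inv hpos.ne')
    rw [key]
    -- Concavity of the logarithm: the gradient term can be discarded.
    have hneg : -1 / (id (w x) + δ) ^ 2 * ∑ i, (fderiv ℝ w x (stdVec i)) ^ 2 ≤ 0 := by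
      refine mul_nonpos_of_nonpos_of_nonneg ?_ (Finset.sum_nonneg fun i _ => sq_nonneg _)
      exact div_nonpos_of_nonpos_of_nonneg (by norm_num) (sq_nonneg _)
    have hρx : HasCompactSupport fun z => ρ (x - z) := hρs.comp_homeomorph (Homeomorph.subLeft x)
    have hmono : ∫ z, f z * ρ (x - z) ∂μ ≤ ∫ z, (w x + δ) * ρ (x - z) ∂μ := by
      refine integral_mono
        (Continuous.integrable_of_hasCompactSupport (by fun_prop) hρx.mul_left)
        (Continuous.integrable_of_hasCompactSupport (by fun_prop) hρx.mul_left) fun z => ?_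
      by_cases hz : e ≤ ‖x - z‖
      · simp [hρz _ hz]
      · refine mul_le_mul_of_nonneg_right ?_ (hρ0 _)
        have h1 := hnear x hx z (by
          rw [Metric.mem_ball, dist_comm, dist_eq_norm]; exact not_le.1 hz)
        have h2 := hwf x hx
        rw [Real.dist_eq] at h1
        linarith [(abs_le.1 h1).2, (abs_le.1 h2).1]
    rw [integral_const_mul] at hmono
    have := (hlap x).trans hmono
    have h3 : (w x + δ)⁻¹ * Laplacian.laplacian w x ≤ ∫ z, ρ (x - z) ∂μ := by
      rw [inv_mul_le_iff₀ hpos]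
      exact this
    linarith

/-! ### The logarithmic estimate around a zero -/

theorem integral_le_toReal_lintegral_ofReal {u : E3 → ℝ} {ν : Measure E3} (hu : Integrable u ν) :
    ∫ x, u x ∂ν ≤ (∫⁻ x, ENNReal.ofReal (u x) ∂ν).toReal := by
  rw [integral_eq_lintegral_pos_part_sub_lintegral_neg_part hu]
  exact sub_le_self _ ENNReal.toReal_nonneg

/-- Moves the kernel from `x` to `z`: when `|x - z| < ε ≤ η`, `|z - y| ≤ |x - y| + η ≤ 2D`, so `1/D
≤ 2/|z - y|`. The condition `ε ≤ R - r` keeps `z` in the ball of the Kato bound. -/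
theorem ofReal_kernel_mul_le {η r R ε : ℝ} {y : E3} (hη : 0 < η) (hr : 0 < r)
    (hεη : ε ≤ η) (hεR : ε ≤ R - r) {ρ : E3 → ℝ} (hρz : ∀ x, ε ≤ ‖x‖ → ρ x = 0) (x z : E3) :
    ENNReal.ofReal (kernel η r y x) * ENNReal.ofReal (ρ (x - z)) ≤
      (Metric.ball y R).indicator (fun z => 2 * ‖z - y‖ₑ⁻¹) z * ENNReal.ofReal (ρ (x - z)) := by
  by_cases hz : ε ≤ ‖x - z‖
  · simp [hρz _ hz]
  by_cases hx : r ≤ ‖x - y‖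
  · simp [kernel_eq_zero y x hr hx]
  push Not at hz hx
  gcongr
  have htri : ‖z - y‖ ≤ ‖x - y‖ + ‖x - z‖ := by
    have := norm_sub_le (x - y) (x - z)
    rwa [sub_sub_sub_cancel_left] at this
  have hzR : z ∈ Metric.ball y R := by
    rw [Metric.mem_ball, dist_eq_norm]
    linarith
  rw [Set.indicator_of_mem hzR]
  rcases eq_or_ne z y with rfl | hne
  · simp
  have hpos : 0 < ‖z - y‖ := norm_pos_iff.2 (sub_ne_zero.2 hne)
  have hD := regDist_pos y x hη
  have hle : kernel η r y x ≤ 2 * ‖z - y‖⁻¹ := by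
    refine (kernel_le y x hη hr).trans ?_
    rw [← div_eq_mul_inv, inv_le_comm₀ hD (by positivity), inv_div, div_le_iff₀ (by norm_num)]
    linarith [norm_le_regDist y x η, le_regDist y x η]
  calc ENNReal.ofReal (kernel η r y x) ≤ ENNReal.ofReal (2 * ‖z - y‖⁻¹) :=
        ENNReal.ofReal_le_ofReal hle
    _ = 2 * ‖z - y‖ₑ⁻¹ := by
        rw [ENNReal.ofReal_mul (by norm_num), ENNReal.ofReal_inv_of_pos hpos, ofReal_norm]
        simp

/-- By Tonelli, the kernel against `ρ * μ` is the mollified kernel against `μ`. The latter is at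
most `2/|z - y|` since `ρ` has mass one, so the bound is independent of `η`, `ε` and `u`. -/
theorem integral_laplacian_mul_kernel_le {μ : Measure E3} [IsLocallyFiniteMeasure μ] {y : E3}
    {η r R ε : ℝ} (hη : 0 < η) (hr : 0 < r) (hεη : ε ≤ η) (hεR : ε ≤ R - r)
    (hC : ∫⁻ x in Metric.ball y R, ‖x - y‖ₑ⁻¹ ∂μ < ∞) {u ρ : E3 → ℝ} (hu : ContDiff ℝ 2 u)
    (hρc : Continuous ρ) (hρ0 : ∀ x, 0 ≤ ρ x) (hρ1 : ∫ x, ρ x = 1)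
    (hρz : ∀ x, ε ≤ ‖x‖ → ρ x = 0)
    (hΔ : ∀ x ∈ Metric.closedBall y r, Laplacian.laplacian u x ≤ ∫ z, ρ (x - z) ∂μ) :
    ∫ x, Laplacian.laplacian u x * kernel η r y x ≤
      2 * (∫⁻ x in Metric.ball y R, ‖x - y‖ₑ⁻¹ ∂μ).toReal := by
  have hkc : Continuous (kernel η r y) := (contDiff_kernel y hη).continuous
  have hks : HasCompactSupport (kernel η r y) :=
    hasCompactSupport_of_eq_zero y fun x hx => kernel_eq_zero y x hr hx
  have hΔc := continuous_laplacian hu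
  have hρs : HasCompactSupport ρ := hasCompactSupport_of_eq_zero (r := ε) 0 fun x hx =>
    hρz x (by simpa using hx)
  have hint : Integrable fun x => Laplacian.laplacian u x * kernel η r y x :=
    Continuous.integrable_of_hasCompactSupport (by fun_prop) hks.mul_left
  refine (integral_le_toReal_lintegral_ofReal hint).trans ?_
  rw [show (2 : ℝ) = (2 : ℝ≥0∞).toReal by simp, ← ENNReal.toReal_mul]
  refine ENNReal.toReal_mono (ENNReal.mul_ne_top (by simp) hC.ne) ?_
  have hρ1' : ∀ z : E3, ∫⁻ x, ENNReal.ofReal (ρ (x - z)) = 1 := by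
    intro z
    rw [lintegral_sub_right_eq_self (fun x => ENNReal.ofReal (ρ x)) z,
      ← ofReal_integral_eq_lintegral_ofReal (hρc.integrable_of_hasCompactSupport hρs)
        (Eventually.of_forall hρ0), hρ1, ENNReal.ofReal_one]
  calc ∫⁻ x, ENNReal.ofReal (Laplacian.laplacian u x * kernel η r y x)
      ≤ ∫⁻ x, ∫⁻ z, ENNReal.ofReal (kernel η r y x) * ENNReal.ofReal (ρ (x - z)) ∂μ := by
        refine lintegral_mono fun x => ?_
        rw [lintegral_const_mul _ (by fun_prop)]
        have hi : Integrable (fun z => ρ (x - z)) μ :=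
          Continuous.integrable_of_hasCompactSupport (by fun_prop)
            (hρs.comp_homeomorph (Homeomorph.subLeft x))
        rw [← ofReal_integral_eq_lintegral_ofReal hi (Eventually.of_forall fun z => hρ0 _),
          ← ENNReal.ofReal_mul (kernel_nonneg y x hη hr)]
        refine ENNReal.ofReal_le_ofReal ?_
        by_cases hx : r ≤ ‖x - y‖
        · simp [kernel_eq_zero y x hr hx]
        · rw [mul_comm]
          refine mul_le_mul_of_nonneg_left (hΔ x ?_) (kernel_nonneg y x hη hr)
          rw [Metric.mem_closedBall, dist_eq_norm]
          exact (not_le.1 hx).le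
    _ = ∫⁻ z, (∫⁻ x, ENNReal.ofReal (kernel η r y x) * ENNReal.ofReal (ρ (x - z))) ∂μ :=
        lintegral_lintegral_swap (by
          refine Measurable.aemeasurable ?_
          unfold Function.uncurry
          fun_prop)
    _ ≤ ∫⁻ z, (Metric.ball y R).indicator (fun z => 2 * ‖z - y‖ₑ⁻¹) z ∂μ := by
        refine lintegral_mono fun z => ?_
        refine (lintegral_mono fun x =>
          ofReal_kernel_mul_le hη hr hεη hεR hρz x z).trans (le_of_eq ?_)
        rw [lintegral_const_mul _ (by fun_prop), hρ1', mul_one]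
    _ = 2 * ∫⁻ x in Metric.ball y R, ‖x - y‖ₑ⁻¹ ∂μ := by
        rw [lintegral_indicator Metric.isOpen_ball.measurableSet, lintegral_const_mul _ (by fun_prop)]

/-- The right side is free of `δ`, and only `η` depends on it. With `a`, `b` the inner and outer
densities, `b = Δk + a`; Green's identity bounds the `Δk` part by the Kato integral. Three copies of
`∫ b` then remain: two errors from `|u - ℓ| ≤ 1` (the one against `a` uses `∫ a = ∫ b`), and one
from `ℓ a ≤ a + 1`. -/
theorem integral_log_mul_outerDensity_le {μ : Measure E3} [IsLocallyFiniteMeasure μ]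
    {f : E3 → ℝ} (hf : Continuous f) (h0 : ∀ x, 0 ≤ f x) (hsup : IsSupersolution μ f) {y : E3}
    (hy : f y = 0) {r R : ℝ} (hr : 0 < r) (hrR : r < R)
    (hC : ∫⁻ x in Metric.ball y R, ‖x - y‖ₑ⁻¹ ∂μ < ∞) {δ : ℝ} (hδ : 0 < δ) :
    ∃ η, 0 < η ∧ η ≤ r / 4 ∧ ∫ x, Real.log (1 + f x / δ) * outerDensity η r y x ≤
      2 * (∫⁻ x in Metric.ball y R, ‖x - y‖ₑ⁻¹ ∂μ).toReal +
        (36 / r ^ 3 + 1) * volume.real (Metric.ball y r) := by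
  set ℓ : E3 → ℝ := fun x => Real.log (1 + f x / δ) with hℓ
  have hone : ∀ x, 1 ≤ 1 + f x / δ := fun x => by
    have := h0 x
    have : 0 ≤ f x / δ := by positivity
    linarith
  have hℓc : Continuous ℓ := Continuous.log (by fun_prop) fun x => by linarith [hone x]
  -- Here the zero of `f` enters: `ℓ y = log 1 = 0`.
  obtain ⟨κ, hκ, hκℓ⟩ : ∃ κ > 0, ∀ x ∈ Metric.ball y κ, ℓ x < 1 :=
    Metric.eventually_nhds_iff_ball.1
      (hℓc.continuousAt.eventually_lt continuousAt_const (by simp [hℓ, hy]))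
  obtain ⟨M, hM⟩ := (isCompact_closedBall y r).exists_bound_of_continuousOn hℓc.continuousOn
  have hM0 : 0 ≤ M := (norm_nonneg _).trans (hM y (Metric.mem_closedBall_self hr.le))
  -- Chosen so that outside `ball y κ`, where `a ≤ 3η²/κ⁵`, the product `ℓ a` is at most `1`; `η ≤
  -- 1` gives `η² ≤ η`.
  set η : ℝ := min (r / 4) (min 1 (κ ^ 5 / (3 * (M + 1)))) with hη
  have hη0 : 0 < η := by positivity
  have hη1 : η ≤ 1 := (min_le_right _ _).trans (min_le_left _ _)
  have hηM : M * (3 * η ^ 2) ≤ κ ^ 5 := by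
    have h1 : η ≤ κ ^ 5 / (3 * (M + 1)) := (min_le_right _ _).trans (min_le_right _ _)
    rw [le_div_iff₀ (by positivity)] at h1
    nlinarith [mul_nonneg hM0 hη0.le]
  refine ⟨η, hη0, min_le_left _ _, ?_⟩
  obtain ⟨u, ρ, hu, hρc, hρ0, hρ1, hρz, hux⟩ := exists_smooth_log hf h0 hsup y r hδ
    (ε := min η (R - r)) (lt_min hη0 (by linarith))
  have hΔ := integral_laplacian_mul_kernel_le hη0 hr (min_le_left η (R - r))
    (min_le_right η (R - r)) hC hu hρc hρ0 hρ1 hρz fun x hx => (hux x hx).2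
  set a := innerDensity η r y with ha
  set b := outerDensity η r y with hb
  have hac : Continuous a := continuous_innerDensity y hη0
  have hbc : Continuous b := continuous_outerDensity y hη0
  have huc := hu.continuous
  have ha0 : ∀ x, 0 ≤ a x := fun x => innerDensity_nonneg y x hη0 hr
  have hb0 : ∀ x, 0 ≤ b x := fun x => outerDensity_nonneg y x hη0 hr
  have haz : ∀ x, r ≤ ‖x - y‖ → a x = 0 := fun x hx => innerDensity_eq_zero y x hr hx
  have hbz : ∀ x, r ≤ ‖x - y‖ → b x = 0 := fun x hx => outerDensity_eq_zero y x hr hx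
  have has : HasCompactSupport a := hasCompactSupport_of_eq_zero y haz
  have hbs : HasCompactSupport b := hasCompactSupport_of_eq_zero y hbz
  have iA : Integrable a := hac.integrable_of_hasCompactSupport has
  have iB : Integrable b := hbc.integrable_of_hasCompactSupport hbs
  have iUA : Integrable fun x => u x * a x :=
    Continuous.integrable_of_hasCompactSupport (by fun_prop) has.mul_left
  have iUB : Integrable fun x => u x * b x :=
    Continuous.integrable_of_hasCompactSupport (by fun_prop) hbs.mul_left
  have iLA : Integrable fun x => ℓ x * a x :=
    Continuous.integrable_of_hasCompactSupport (by fun_prop) has.mul_left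
  have iLB : Integrable fun x => ℓ x * b x :=
    Continuous.integrable_of_hasCompactSupport (by fun_prop) hbs.mul_left
  have hmem : ∀ x, ¬ r ≤ ‖x - y‖ → x ∈ Metric.closedBall y r := fun x hx => by
    rw [Metric.mem_closedBall, dist_eq_norm]
    exact (not_le.1 hx).le
  have hvol : volume (Metric.ball y r) ≠ ∞ := measure_ball_lt_top.ne
  have iI : ∀ c : ℝ, Integrable ((Metric.ball y r).indicator fun _ => c) := fun c =>
    (integrable_indicator_iff Metric.isOpen_ball.measurableSet).2 (integrableOn_const hvol)
  have vI : ∀ c : ℝ, ∫ x, (Metric.ball y r).indicator (fun _ => c) x =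
      c * volume.real (Metric.ball y r) := fun c => by
    rw [integral_indicator Metric.isOpen_ball.measurableSet, setIntegral_const, smul_eq_mul,
      mul_comm]
  have hind : ∀ (c : ℝ) x, ¬ r ≤ ‖x - y‖ → (Metric.ball y r).indicator (fun _ => c) x = c :=
    fun c x hx => Set.indicator_of_mem (by
      rw [Metric.mem_ball, dist_eq_norm]; exact not_le.1 hx) _
  have hind' : ∀ (c : ℝ) x, r ≤ ‖x - y‖ → (Metric.ball y r).indicator (fun _ => c) x = 0 :=
    fun c x hx => Set.indicator_of_notMem (by
      rw [Metric.mem_ball, dist_eq_norm]; exact not_lt.2 hx) _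
  have hks : HasCompactSupport (kernel η r y) :=
    hasCompactSupport_of_eq_zero y fun x hx => kernel_eq_zero y x hr hx
  have I1 : ∫ x, ℓ x * b x ≤ (∫ x, u x * b x) + ∫ x, b x := by
    rw [← integral_add iUB iB]
    refine integral_mono iLB (iUB.add iB) fun x => ?_
    by_cases hx : r ≤ ‖x - y‖
    · simp [hbz x hx]
    · have := (abs_le.1 (hux x (hmem x hx)).1).1
      nlinarith [mul_le_mul_of_nonneg_right (show ℓ x ≤ u x + 1 by linarith) (hb0 x)]
  have I2 : ∫ x, u x * b x =
      (∫ x, u x * Laplacian.laplacian (kernel η r y) x) + ∫ x, u x * a x := by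
    have : ∀ x, u x * Laplacian.laplacian (kernel η r y) x = u x * b x - u x * a x := fun x => by
      rw [laplacian_kernel y x hη0 hr]; ring
    simp only [this]
    rw [integral_sub iUB iUA]
    ring
  have I3 := integral_mul_laplacian_comm hu (contDiff_kernel (r := r) y hη0) hks
  have I4 : ∫ x, u x * a x ≤ (∫ x, ℓ x * a x) + ∫ x, a x := by
    rw [← integral_add iLA iA]
    refine integral_mono iUA (iLA.add iA) fun x => ?_
    by_cases hx : r ≤ ‖x - y‖
    · simp [haz x hx]
    · have := (abs_le.1 (hux x (hmem x hx)).1).2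
      nlinarith [mul_le_mul_of_nonneg_right (show u x ≤ ℓ x + 1 by linarith) (ha0 x)]
  have I5 : ∫ x, ℓ x * a x ≤ (∫ x, a x) + 1 * volume.real (Metric.ball y r) := by
    rw [← vI 1, ← integral_add iA (iI 1)]
    refine integral_mono iLA (iA.add (iI 1)) fun x => ?_
    beta_reduce
    by_cases hx : r ≤ ‖x - y‖
    · simp [haz x hx, hind' _ x hx]
    · rw [hind _ x hx]
      by_cases hxκ : x ∈ Metric.ball y κ
      · nlinarith [hκℓ x hxκ, ha0 x]
      · rw [Metric.mem_ball, dist_eq_norm, not_lt] at hxκ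
        have hD : κ ≤ regDist η y x := hxκ.trans (norm_le_regDist y x η)
        have h1 : a x ≤ 3 * η ^ 2 / κ ^ 5 :=
          (innerDensity_le y x hη0 hr).trans (by gcongr)
        have h2 : ℓ x ≤ M := (le_abs_self _).trans (hM x (hmem x hx))
        have h3 : ℓ x * a x ≤ M * (3 * η ^ 2 / κ ^ 5) := mul_le_mul h2 h1 (ha0 x) hM0
        have h4 : M * (3 * η ^ 2 / κ ^ 5) ≤ 1 := by
          rw [← mul_div_assoc, div_le_one (by positivity)]
          exact hηM
        linarith [ha0 x]
  -- Green's identity against the constant `1`: the Laplacian of the kernel has zero mean.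
  have I6 : ∫ x, a x = ∫ x, b x := by
    have h1 := integral_mul_laplacian_comm (u := fun _ => 1) contDiff_const
      (contDiff_kernel (r := r) y hη0) hks
    have h2 : ∀ x, Laplacian.laplacian (fun _ : E3 => (1 : ℝ)) x = 0 := fun x => by
      rw [laplacian_eq_sum_fderiv]
      simp
    simp only [h2, zero_mul, integral_zero, one_mul, laplacian_kernel y _ hη0 hr] at h1
    rw [integral_sub iB iA] at h1
    linarith
  have I7 : ∫ x, b x ≤ 12 / r ^ 3 * volume.real (Metric.ball y r) := by
    rw [← vI]
    refine integral_mono iB (iI _) fun x => ?_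
    by_cases hx : r ≤ ‖x - y‖
    · simp [hbz x hx, hind' _ x hx]
    · rw [hind _ x hx]
      exact outerDensity_le y x hη0 hr
  have : (36 / r ^ 3 + 1) * volume.real (Metric.ball y r) =
      3 * (12 / r ^ 3 * volume.real (Metric.ball y r)) + 1 * volume.real (Metric.ball y r) := by
    ring
  rw [this]
  linarith

/-- A non-negative supersolution vanishes near each of its zeros at which the potential is of
Kato type. -/
theorem IsSupersolution.eq_zero_of_mem_ball {μ : Measure E3} [IsLocallyFiniteMeasure μ]
    {f : E3 → ℝ} (hf : Continuous f) (h0 : ∀ x, 0 ≤ f x) (hsup : IsSupersolution μ f) {y : E3}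
    (hy : f y = 0) {R : ℝ} (hC : ∫⁻ x in Metric.ball y R, ‖x - y‖ₑ⁻¹ ∂μ < ∞) {x₀ : E3}
    (hx₀ : x₀ ∈ Metric.ball y (R / 2)) : f x₀ = 0 := by
  by_contra hne
  have hfx : 0 < f x₀ := lt_of_le_of_ne (h0 _) (Ne.symm hne)
  have hxy : x₀ ≠ y := fun h => hne (h ▸ hy)
  rw [Metric.mem_ball, dist_eq_norm] at hx₀
  have hd : 0 < ‖x₀ - y‖ := norm_pos_iff.2 (sub_ne_zero.2 hxy)
  -- Places `x₀` at distance `r/2` from `y`, so `ball x₀ (r/4)` lies in the annulus where the outer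
  -- density is bounded below.
  set r : ℝ := 2 * ‖x₀ - y‖ with hr
  have hr0 : 0 < r := by positivity
  have hrR : r < R := by linarith
  obtain ⟨s, hs, hsf⟩ : ∃ s > 0, ∀ x ∈ Metric.ball x₀ s, f x₀ / 2 < f x :=
    Metric.eventually_nhds_iff_ball.1
      (continuousAt_const.eventually_lt hf.continuousAt (by linarith))
  set m := f x₀ / 2
  have hm : 0 < m := by positivity
  set U := Metric.ball x₀ (min s (r / 4)) with hU
  have hUpos : 0 < volume.real U :=
    ENNReal.toReal_pos (Metric.measure_ball_pos volume x₀ (by positivity)).ne'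
      measure_ball_lt_top.ne
  set K := 2 * (∫⁻ x in Metric.ball y R, ‖x - y‖ₑ⁻¹ ∂μ).toReal +
        (36 / r ^ 3 + 1) * volume.real (Metric.ball y r)
  set c := 1 / (5 * r ^ 3) * volume.real U with hc
  have hc0 : 0 < c := by positivity
  set T := (|K| + 1) / c with hT
  have hT0 : 0 < T := by positivity
  -- Makes the logarithm at least `T` wherever `f ≥ m`. The integral is then at least `T * c = |K| +
  -- 1`, while `K`, fixed before `δ`, is an upper bound.
  set δ := m * Real.exp (-T) with hδ
  have hδ0 : 0 < δ := by positivity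
  obtain ⟨η, hη, hηr, hle⟩ := integral_log_mul_outerDensity_le hf h0 hsup hy hr0 hrR hC hδ0
  have hone : ∀ x, 1 ≤ 1 + f x / δ := fun x => by
    have := h0 x
    have : 0 ≤ f x / δ := by positivity
    linarith
  have hbc : Continuous (outerDensity η r y) := continuous_outerDensity y hη
  have hℓc : Continuous fun x => Real.log (1 + f x / δ) :=
    Continuous.log (by fun_prop) fun x => by linarith [hone x]
  have hbs : HasCompactSupport (outerDensity η r y) :=
    hasCompactSupport_of_eq_zero y fun x hx => outerDensity_eq_zero y x hr0 hx
  have hint : Integrable fun x => Real.log (1 + f x / δ) * outerDensity η r y x :=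
    Continuous.integrable_of_hasCompactSupport (by fun_prop) hbs.mul_left
  have hlow : T * c ≤ ∫ x, Real.log (1 + f x / δ) * outerDensity η r y x := by
    have hvU : ∫ x, U.indicator (fun _ => T * (1 / (5 * r ^ 3))) x = T * c := by
      rw [integral_indicator Metric.isOpen_ball.measurableSet, setIntegral_const, smul_eq_mul, hc]
      ring
    rw [← hvU]
    refine integral_mono ((integrable_indicator_iff Metric.isOpen_ball.measurableSet).2
      (integrableOn_const measure_ball_lt_top.ne)) hint fun x => ?_
    by_cases hx : x ∈ U
    · rw [Set.indicator_of_mem hx]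
      rw [hU, Metric.mem_ball, lt_min_iff] at hx
      have hlog : T ≤ Real.log (1 + f x / δ) := by
        rw [Real.le_log_iff_exp_le (by linarith [hone x])]
        have h1 : m ≤ f x := (hsf x (Metric.mem_ball.2 hx.1)).le
        have h2 : Real.exp T = m / δ := by
          rw [hδ, Real.exp_neg]
          field_simp
        have h3 : m / δ ≤ f x / δ := by gcongr
        linarith
      have hdist := hx.2
      rw [dist_eq_norm] at hdist
      have t1 : ‖x - y‖ ≤ ‖x - x₀‖ + ‖x₀ - y‖ := norm_sub_le_norm_sub_add_norm_sub x x₀ y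
      have t2 : ‖x₀ - y‖ ≤ ‖x₀ - x‖ + ‖x - y‖ := norm_sub_le_norm_sub_add_norm_sub x₀ x y
      rw [norm_sub_rev x₀ x] at t2
      exact mul_le_mul hlog (le_outerDensity y x hη hr0 hηr (by linarith) (by linarith))
        (by positivity) (hT0.le.trans hlog)
    · rw [Set.indicator_of_notMem hx]
      exact mul_nonneg (Real.log_nonneg (hone x)) (outerDensity_nonneg y x hη hr0)
  have hTc : T * c = |K| + 1 := div_mul_cancel₀ _ hc0.ne'
  linarith [le_abs_self K]

end StrongMax

theorem mainTheorem11 (V : StrongMax.Potential) (hV : V.MemKLoc)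
    (f : StrongMax.E3 → ℝ) (hf : StrongMax.MemInvLaplacianK0Loc f) (hf0 : ∀ x, 0 ≤ f x)
    (g : MeasureTheory.Measure StrongMax.E3) (hsol : StrongMax.SolvesBVP V f g)
    (hne : ∃ x, f x ≠ 0) :
    ∀ x, 0 < f x := by
  have hc : Continuous f := hf.continuous
  have hsup := hsol.2.1.isSupersolution hf0
  have := V.finite_pos
  have hopen : IsOpen {x | f x = 0} := by
    rw [Metric.isOpen_iff]
    intro y hy
    obtain ⟨R, hR, hC⟩ := hV y
    have hC' : ∫⁻ x in Metric.ball y R, ‖x - y‖ₑ⁻¹ ∂V.pos < ∞ := by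
      refine lt_of_le_of_lt (lintegral_mono' ?_ le_rfl) hC
      exact Measure.restrict_mono_measure (Measure.le_add_right le_rfl) _
    exact ⟨R / 2, by positivity, fun x hx => hsup.eq_zero_of_mem_ball hc hf0 hy hC' hx⟩
  -- By connectedness of `ℝ³`, a single zero would force `f` to vanish identically.
  have hclopen : IsClopen {x | f x = 0} := ⟨isClosed_eq hc continuous_const, hopen⟩
  intro x
  refine lt_of_le_of_ne (hf0 x) fun hx => ?_
  have huniv := hclopen.eq_univ ⟨x, hx.symm⟩
  obtain ⟨z, hz⟩ := hne
  exact hz (huniv.symm ▸ Set.mem_univ z : z ∈ {x | f x = 0})
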